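/- Let $\mathcal N_2$ be the variety of groups $G$ that are nilpotent of class at most two, i.e. $[G,G]\subseteq Z(G)$, and let $\mathcal B_m$ be the variety of groups satisfying $g^m=e$ for all $g$. An amalgam $(A,C;G)$ of groups from a class $\mathcal C$ with core $G$ consists of groups $A,C,G\in\mathcal C$ and injective homomorphisms $\Phi_A\colon G\to A$, $\Phi_C\colon G\to C$. It is weakly embeddable into an $\mathcal N_2$-group if there are a group $M\in\mathcal N_2$ and injective homomorphisms $\lambda_A\colon A\to M$, $\lambda_C\colon C\to M$, $\lambda\colon G\to M$ with $\lambda_A\Phi_A=\lambda=\lambda_C\Phi_C$; it is strongly embeddable into an $\mathcal N_2$-group if these can be chosen so that, moreover, $\lambda_A(a)\neq\lambda_C(c)$ for all $a\in A\setminus\Phi_A(G)$ and $c\in C\setminus\Phi_C(G)$. A group $G\in\mathcal N_2$ is a strong amalgamation base in $\mathcal N_2$ if every amalgam of $\mathcal N_2$-groups with core $G$ is strongly embeddable into an $\mathcal N_2$-group. Let $p$ be an odd prime, $n\ge 0$ an integer, and $G\in\mathcal N_2\cap\mathcal B_{p^n}$. Then the following are equivalent: (1) $G$ is a strong amalgamation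 base in $\mathcal N_2$; (2) every amalgam of $\mathcal N_2\cap\mathcal B_{p^n}$-groups with core $G$ is strongly embeddable into an $\mathcal N_2$-group; (3) every amalgam of $\mathcal N_2\cap\mathcal B_{p^n}$-groups with core $G$ is weakly embeddable into an $\mathcal N_2$-group. -/

import Mathlib

universe u

/-- A class of groups (in a fixed universe). -/
abbrev GroupClass := ∀ (G : Type u) [Group G], Prop

/-- The variety `N₂` of nilpotent groups of class at most two: `[G, G] ⊆ Z(G)`. -/
def NilTwo : GroupClass.{u} := fun G _ => commutator G ≤ Subgroup.center G

/-- The variety `B_m` of groups of exponent (dividing) `m`: `g ^ m = e` for all `g`. -/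
def Burnside (m : ℕ) : GroupClass.{u} := fun G _ => ∀ g : G, g ^ m = 1

/-- The variety `N₂ ∩ B_m`. -/
def NilTwoBurnside (m : ℕ) : GroupClass.{u} := fun G _ => NilTwo G ∧ Burnside m G

/-- An amalgam `(A, C; G)` of groups with core `G`: two groups `A = left` and `C = right`
with injective homomorphisms `G → A` and `G → C`. -/
structure Amalgam (G : Type u) [Group G] where
  left : Type u
  right : Type u
  [groupLeft : Group left]
  [groupRight : Group right]
  toLeft : G →* left
  toRight : G →* right
  toLeft_injective : Function.Injective toLeft
  toRight_injective : Function.Injective toRight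

attribute [instance] Amalgam.groupLeft Amalgam.groupRight

namespace Amalgam

variable {G : Type u} [Group G]

/-- `𝒜` is an amalgam of `𝒞`-groups: its core and both of its factors lie in `𝒞`. -/
def Of (𝒞 : GroupClass.{u}) (𝒜 : Amalgam G) : Prop :=
  𝒞 G ∧ 𝒞 𝒜.left ∧ 𝒞 𝒜.right

/-- An embedding of an amalgam into a group `M`: injective homomorphisms from both factors and
from the core to `M` which are compatible with the maps of the amalgam. -/
structure Embedding (𝒜 : Amalgam G) (M : Type u) [Group M] where
  left : 𝒜.left →* M
  right : 𝒜.right →* M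
  core : G →* M
  left_injective : Function.Injective left
  right_injective : Function.Injective right
  core_injective : Function.Injective core
  left_comp : left.comp 𝒜.toLeft = core
  right_comp : right.comp 𝒜.toRight = core

/-- An embedding of `(A, C; G)` is strong if no element of `A ∖ G` is identified with an element
of `C ∖ G`. -/
def Embedding.IsStrong {𝒜 : Amalgam G} {M : Type u} [Group M] (f : 𝒜.Embedding M) : Prop :=
  ∀ a ∉ Set.range 𝒜.toLeft, ∀ c ∉ Set.range 𝒜.toRight, f.left a ≠ f.right c

/-- The amalgam is weakly embeddable in the class `𝒞`. -/
def WeaklyEmbeddable (𝒞 : GroupClass.{u}) (𝒜 : Amalgam G) : Prop :=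
  ∃ (M : Type u) (_ : Group M), 𝒞 M ∧ Nonempty (𝒜.Embedding M)

/-- The amalgam is strongly embeddable in the class `𝒞`. -/
def StronglyEmbeddable (𝒞 : GroupClass.{u}) (𝒜 : Amalgam G) : Prop :=
  ∃ (M : Type u) (_ : Group M), 𝒞 M ∧ ∃ f : 𝒜.Embedding M, f.IsStrong

end Amalgam

/-- `G` is a strong amalgamation base for `𝒞`: it lies in `𝒞`, and every amalgam of `𝒞`-groups
with core `G` is strongly embeddable in `𝒞`. -/
def IsStrongAmalgamationBase (𝒞 : GroupClass.{u}) (G : Type u) [Group G] : Prop :=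
  𝒞 G ∧ ∀ 𝒜 : Amalgam G, 𝒜.Of 𝒞 → 𝒜.StronglyEmbeddable 𝒞

-- Only (3) ⇒ (1) needs work, and it uses only that `m = p ^ n` is odd. The link is purity: for
-- every overgroup `A` of `G` of class two, the map of abelianizations Gᵃᵇ → Aᵃᵇ is a pure
-- monomorphism.
--
-- Weak embeddability forces purity (`exists_eq_pow_mul_of_weaklyEmbeddable`). If g = a^q s in `A`
-- with s ∈ [A, A], then [b, g] = [b, a]^q for all b, so `g` commutes with every `y` in `G` such
-- that y^q g^k ∈ [G, G] for some k. This condition suffices to build an overgroup of exponent `m`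
-- in which again g = a^q s. If `g` were not a q-th power modulo [G, G], another overgroup of
-- exponent `m` would contain `c` with c^q = 1 and [g, c] ≠ 1. In a common overgroup of class two,
-- [g, c] = [a, c]^q = [a, c^q] = 1, a contradiction.
--
-- Purity gives strong embeddings (`exists_strong_embedding`). The class-two coproduct of `A` and
-- `C` is a central extension of A × C by Aᵃᵇ ⊗ Cᵃᵇ. Identifying the two copies of `G` imposes
-- relations on the tensor product, and these collapse nothing further because, by purity, Aᵃᵇ ⊗ Gᵃᵇ
-- and Gᵃᵇ ⊗ Cᵃᵇ embed in it and meet in Gᵃᵇ ⊗ Gᵃᵇ.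

universe v

open scoped commutatorElement TensorProduct DirectSum IsMulCommutative

/-! ### Pure subgroups of abelian groups and tensor products. -/

/-- If torsion elements of `T` lift along `π` to elements killed by the same integer, then every
homomorphism from a finitely generated group to `T` lifts along `π`. -/
theorem exists_lift_of_forall_nsmul {Q T S : Type*} [AddCommGroup Q] [AddCommGroup T]
    [AddCommGroup S] [AddGroup.FG S] (π : Q →+ T)
    (hπ : ∀ (m : ℕ) (t : T), m • t = 0 → ∃ q, π q = t ∧ m • q = 0) (f : S →+ T) :
    ∃ s : S →+ Q, π.comp s = f := by
  classical
  obtain ⟨n, ι, _, p, _, e, ⟨E⟩⟩ := AddCommGroup.equiv_free_prod_directSum_zmod S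
  -- The case m = 0 of `hπ` is plain surjectivity, which is enough for the free generators.
  have h₁ : ∀ i : Fin n, ∃ q, π q = f (E.symm (Finsupp.single i 1, 0)) := fun i =>
    (hπ 0 _ (zero_nsmul _)).imp fun _ h => h.1
  have h₂ : ∀ i : ι, ∃ q, π q = f (E.symm (0, DirectSum.of _ i 1)) ∧ p i ^ e i • q = 0 := by
    intro i
    apply hπ
    rw [← map_nsmul, ← map_nsmul, Prod.smul_mk, smul_zero, ← map_nsmul]
    simp only [nsmul_eq_mul, mul_one, CharP.cast_eq_zero, map_zero]
    exact (congrArg f (map_zero E.symm)).trans (map_zero f)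
  choose a ha using h₁
  choose b hb hb' using h₂
  let s₁ : (Fin n →₀ ℤ) →+ Q := (Finsupp.linearCombination ℤ a).toAddMonoidHom
  let s₂ : (⨁ i, ZMod (p i ^ e i)) →+ Q := DirectSum.toAddMonoid fun i =>
    ZMod.lift (p i ^ e i) ⟨(zmultiplesHom Q) (b i), by simpa using mod_cast hb' i⟩
  have hs₁ : π.comp s₁ = (f.comp E.symm.toAddMonoidHom).comp (AddMonoidHom.inl _ _) := by
    ext i
    simpa [s₁] using ha i
  have hs₂ : π.comp s₂ = (f.comp E.symm.toAddMonoidHom).comp (AddMonoidHom.inr _ _) := by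
    refine DirectSum.addHom_ext' fun i => ?_
    refine AddMonoidHom.ext fun x => ?_
    obtain ⟨k, rfl⟩ := ZMod.intCast_surjective x
    have : DirectSum.of (fun i => ZMod (p i ^ e i)) i (k : ZMod (p i ^ e i)) =
        k • DirectSum.of (fun i => ZMod (p i ^ e i)) i 1 := by
      rw [← map_zsmul]; simp
    have h0 : ((0, k • DirectSum.of (fun i => ZMod (p i ^ e i)) i 1) :
        (Fin n →₀ ℤ) × ⨁ i, ZMod (p i ^ e i)) = k • (0, DirectSum.of _ i 1) := by simp
    have h1 : s₂ (DirectSum.of _ i 1) = b i := by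
      have := ZMod.lift_coe (p i ^ e i) ⟨(zmultiplesHom Q) (b i), by simpa using mod_cast hb' i⟩ 1
      simpa [s₂] using this
    change π (s₂ (DirectSum.of _ i k)) = f (E.symm (0, DirectSum.of _ i k))
    rw [this, map_zsmul, map_zsmul, h0, map_zsmul, map_zsmul, ← hb, h1]
  refine ⟨(s₁.coprod s₂).comp E.toAddMonoidHom, ?_⟩
  ext x
  obtain ⟨⟨y, z⟩, rfl⟩ := E.symm.surjective x
  have e₁ := DFunLike.congr_fun hs₁ y
  have e₂ := DFunLike.congr_fun hs₂ z
  simp only [AddMonoidHom.coe_comp, Function.comp_apply, AddMonoidHom.inl_apply,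
    AddMonoidHom.inr_apply, AddEquiv.coe_toAddMonoidHom] at e₁ e₂
  simp only [AddMonoidHom.coe_comp, Function.comp_apply, AddEquiv.coe_toAddMonoidHom,
    AddEquiv.apply_symm_apply, AddMonoidHom.coprod_apply, map_add, e₁, e₂]
  rw [← map_add, ← map_add]
  simp

/-- A homomorphism `j : R → Q` of abelian groups is a pure monomorphism if every element of `R`
which is divisible by `q` in `Q` is divisible by `q` in `R`, for every `q ≥ 0`. -/
def PureMono {R Q : Type*} [AddCommGroup R] [AddCommGroup Q] (j : R →ₗ[ℤ] Q) : Prop :=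
  ∀ (q : ℕ) (r : R) (x : Q), j r = q • x → ∃ r' : R, r = q • r'

namespace PureMono

variable {R Q P : Type*} [AddCommGroup R] [AddCommGroup Q] [AddCommGroup P]

theorem injective {j : R →ₗ[ℤ] Q} (hj : PureMono j) : Function.Injective j := by
  rw [injective_iff_map_eq_zero]
  intro r hr
  obtain ⟨r', h⟩ := hj 0 r 0 (by simpa using hr)
  simpa using h

/-- A pure subgroup is a retract of every finitely generated overgroup. -/
theorem exists_retraction {j : R →ₗ[ℤ] Q} (hj : PureMono j) (N : Submodule ℤ Q) (hN : N.FG) :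
    ∃ ρ : N →ₗ[ℤ] R, ∀ r (h : j r ∈ N), ρ ⟨j r, h⟩ = r := by
  let π := (LinearMap.range j).mkQ
  let S := N.map π
  have hS : Module.Finite ℤ S := Module.Finite.iff_fg.2 (hN.map π)
  have hS' : AddGroup.FG S := Module.Finite.iff_addGroup_fg.1 hS
  have hπ : ∀ (m : ℕ) (t : Q ⧸ LinearMap.range j), m • t = 0 →
      ∃ q, π.toAddMonoidHom q = t ∧ m • q = 0 := by
    intro m t ht
    obtain ⟨q, rfl⟩ := (LinearMap.range j).mkQ_surjective t
    rw [← map_nsmul, Submodule.mkQ_apply, Submodule.Quotient.mk_eq_zero] at ht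
    obtain ⟨r, hr⟩ := ht
    obtain ⟨r', rfl⟩ := hj m r q hr
    refine ⟨q - j r', ?_, ?_⟩
    · have : π (j r') = 0 := by simp [π]
      change π (q - j r') = π q
      rw [map_sub, this, sub_zero]
    · rw [smul_sub, ← hr, map_nsmul, sub_self]
  obtain ⟨s, hs⟩ := exists_lift_of_forall_nsmul π.toAddMonoidHom hπ S.subtype.toAddMonoidHom
  have hs' : ∀ x : S, π (s x) = x := fun x => DFunLike.congr_fun hs x
  let τ : N →ₗ[ℤ] S := (π.comp N.subtype).codRestrict S fun x => ⟨x, x.2, rfl⟩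
  -- Subtracting the lift of the class modulo the range of `j` moves `N` into that range and fixes
  -- what already lies there.
  let δ : N →ₗ[ℤ] Q := N.subtype - s.toIntLinearMap.comp τ
  have hδ : ∀ x, δ x ∈ LinearMap.range j := by
    intro x
    rw [← Submodule.Quotient.mk_eq_zero, ← Submodule.mkQ_apply]
    change π ((x : Q) - s (τ x)) = 0
    rw [map_sub, hs']
    exact sub_self _
  let E := LinearEquiv.ofInjective j hj.injective
  refine ⟨E.symm.toLinearMap.comp (δ.codRestrict _ hδ), fun r h => ?_⟩
  change E.symm _ = r
  rw [LinearEquiv.symm_apply_eq]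
  ext
  have : τ ⟨j r, h⟩ = 0 := by
    ext
    change π (j r) = 0
    simp [π]
  change j r - s (τ ⟨j r, h⟩) = j r
  rw [this, map_zero, sub_zero]

/-- A tensor that vanishes over `Q` already vanishes over some finitely generated subgroup `N`, and
a retraction of `N` to `R` carries this vanishing back. -/
theorem rTensor_injective {j : R →ₗ[ℤ] Q} (hj : PureMono j) (X : Type*) [AddCommGroup X] :
    Function.Injective (j.rTensor X) := by
  rw [injective_iff_map_eq_zero]
  intro t ht
  obtain ⟨R₀, hR₀, hmem⟩ := TensorProduct.exists_finite_submodule_left_of_setFinite {t}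
    (Set.finite_singleton t)
  obtain ⟨t₀, rfl⟩ := hmem rfl
  let P := R₀.map j
  have hP : P.FG := (Module.Finite.iff_fg.1 hR₀).map j
  let j₀ : R₀ →ₗ[ℤ] P := (j.comp R₀.subtype).codRestrict P fun x => ⟨x, x.2, rfl⟩
  have h0 : P.subtype.rTensor X (j₀.rTensor X t₀) = 0 := by
    rw [← ht, ← LinearMap.comp_apply, ← LinearMap.comp_apply, ← LinearMap.rTensor_comp,
      ← LinearMap.rTensor_comp]
    rfl
  obtain ⟨N, hPN, hN, h⟩ := TensorProduct.eq_zero_of_fg_of_subtype_eq_zero hP h0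
  obtain ⟨ρ, hρ⟩ := hj.exists_retraction N hN
  have : R₀.subtype = ρ.comp ((Submodule.inclusion hPN).comp j₀) := by
    ext x
    exact (hρ x.1 _).symm
  rw [this, LinearMap.rTensor_comp, LinearMap.rTensor_comp, LinearMap.comp_apply,
    LinearMap.comp_apply, h, map_zero]

theorem lTensor_injective {j : R →ₗ[ℤ] Q} (hj : PureMono j) (X : Type*) [AddCommGroup X] :
    Function.Injective (j.lTensor X) := by
  rw [← LinearMap.comm_comp_rTensor_comp_comm_eq]
  simpa using hj.rTensor_injective X

/-- If `R` is pure in `P` and in `Q`, then `P ⊗ R` and `R ⊗ Q` meet in `R ⊗ R` inside `P ⊗ Q`. -/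
theorem exists_of_lTensor_add_rTensor_eq_zero {i : R →ₗ[ℤ] P} {j : R →ₗ[ℤ] Q} (hi : PureMono i)
    (hj : PureMono j) (x : P ⊗[ℤ] R) (y : R ⊗[ℤ] Q)
    (h : j.lTensor P x + i.rTensor Q y = 0) :
    ∃ w : R ⊗[ℤ] R, x = i.rTensor R w ∧ y = -j.lTensor R w := by
  let π := (LinearMap.range i).mkQ
  have hex : Function.Exact i π := LinearMap.exact_map_mkQ_range i
  have hsurj : Function.Surjective π := Submodule.mkQ_surjective _
  -- Modulo the range of `i` the second summand of `h` dies, and purity of `j` allows cancelling `j`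
  -- in the first.
  have h1 : π.rTensor R x = 0 := by
    apply hj.lTensor_injective
    have h2 : π.rTensor Q (i.rTensor Q y) = 0 := (rTensor_exact Q hex hsurj _).2 ⟨y, rfl⟩
    have h3 := congrArg (π.rTensor Q) h
    rw [map_add, h2, add_zero, map_zero, ← LinearMap.comp_apply, LinearMap.rTensor_comp_lTensor,
      ← LinearMap.lTensor_comp_rTensor] at h3
    rw [map_zero]
    exact h3
  obtain ⟨w, rfl⟩ := (rTensor_exact R hex hsurj x).1 h1
  refine ⟨w, rfl, ?_⟩
  apply hi.rTensor_injective
  rw [map_neg, eq_neg_iff_add_eq_zero, add_comm, ← h]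
  congr 1
  rw [← LinearMap.comp_apply, ← LinearMap.comp_apply, LinearMap.rTensor_comp_lTensor,
      LinearMap.lTensor_comp_rTensor]

end PureMono

/-! ### Commutator calculus in class two. -/

section NilTwo

variable {G : Type u} {H : Type v} [Group G] [Group H]

theorem nilTwo_iff : NilTwo G ↔ ∀ x y z : G, Commute ⁅x, y⁆ z := by
  unfold NilTwo
  rw [commutator_def, Subgroup.commutator_le]
  constructor
  · intro h x y z
    exact (Subgroup.mem_center_iff.1 (h x trivial y trivial) z).symm
  · intro h x _ y _
    exact Subgroup.mem_center_iff.2 fun z => (h x y z).symm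

theorem NilTwo.commute (h : NilTwo G) (x y z : G) : Commute ⁅x, y⁆ z := nilTwo_iff.1 h x y z

theorem NilTwo.commute_of_mem (h : NilTwo G) {x : G} (hx : x ∈ commutator G) (z : G) :
    Commute x z :=
  (Subgroup.mem_center_iff.1 (h hx) z).symm

theorem NilTwo.commutatorElement_mul_left (h : NilTwo G) (x y z : G) :
    ⁅x * y, z⁆ = ⁅x, z⁆ * ⁅y, z⁆ := by
  have := (h.commute y z x).eq
  calc ⁅x * y, z⁆ = x * ⁅y, z⁆ * z * x⁻¹ * z⁻¹ := by simp only [commutatorElement_def]; group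
    _ = ⁅y, z⁆ * ⁅x, z⁆ := by rw [← this]; simp only [commutatorElement_def]; group
    _ = _ := (h.commute y z _).eq

theorem NilTwo.commutatorElement_mul_right (h : NilTwo G) (x y z : G) :
    ⁅x, y * z⁆ = ⁅x, y⁆ * ⁅x, z⁆ := by
  rw [← commutatorElement_inv, h.commutatorElement_mul_left, mul_inv_rev, commutatorElement_inv,
    commutatorElement_inv, (h.commute x z _).eq]

/-- In a group of class at most two, the commutator with a fixed element is a homomorphism. -/
def NilTwo.commutatorHom (h : NilTwo G) (x : G) : G →* Subgroup.center G where
  toFun y := ⟨⁅x, y⁆, h (Subgroup.commutator_mem_commutator trivial trivial)⟩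
  map_one' := by ext; simp
  map_mul' y z := by ext; exact h.commutatorElement_mul_right x y z

theorem NilTwo.commutatorElement_pow_right (h : NilTwo G) (x y : G) (k : ℕ) :
    ⁅x, y ^ k⁆ = ⁅x, y⁆ ^ k :=
  congrArg Subtype.val (map_pow (h.commutatorHom x) y k)

theorem NilTwo.commutatorElement_zpow_right (h : NilTwo G) (x y : G) (k : ℤ) :
    ⁅x, y ^ k⁆ = ⁅x, y⁆ ^ k :=
  congrArg Subtype.val (map_zpow (h.commutatorHom x) y k)

theorem NilTwo.commutatorElement_pow_left (h : NilTwo G) (x y : G) (k : ℕ) :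
    ⁅x ^ k, y⁆ = ⁅x, y⁆ ^ k := by
  rw [← commutatorElement_inv, h.commutatorElement_pow_right, ← inv_pow, commutatorElement_inv]

theorem NilTwo.prod (hG : NilTwo G) (hH : NilTwo H) : NilTwo (G × H) :=
  nilTwo_iff.2 fun x y z =>
    Prod.ext (hG.commute x.1 y.1 z.1).eq (hH.commute x.2 y.2 z.2).eq

theorem NilTwo.of_surjective (hG : NilTwo G) (f : G →* H) (hf : Function.Surjective f) :
    NilTwo H := by
  rw [nilTwo_iff, hf.forall₂]
  intro x y
  rw [hf.forall]
  intro z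
  rw [← map_commutatorElement]
  exact (hG.commute x y z).map f

theorem map_mem_commutator (f : G →* H) {x : G} (hx : x ∈ commutator G) : f x ∈ commutator H := by
  have : commutator G ≤ (commutator H).comap f := by
    rw [commutator_def, Subgroup.commutator_le]
    intro x _ y _
    rw [Subgroup.mem_comap, map_commutatorElement]
    exact Subgroup.commutator_mem_commutator trivial trivial
  exact this hx

theorem nilTwo_of_commGroup (G : Type u) [CommGroup G] : NilTwo G :=
  nilTwo_iff.2 fun _ _ _ => Commute.all _ _

theorem Burnside.prod {m : ℕ} (hG : Burnside m G) (hH : Burnside m H) : Burnside m (G × H) :=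
  fun x => Prod.ext (hG x.1) (hH x.2)

theorem Burnside.of_surjective {m : ℕ} (hG : Burnside m G) (f : G →* H)
    (hf : Function.Surjective f) : Burnside m H := by
  intro x
  obtain ⟨x, rfl⟩ := hf x
  rw [← map_pow, hG, map_one]

theorem NilTwoBurnside.prod {m : ℕ} (hG : NilTwoBurnside m G) (hH : NilTwoBurnside m H) :
    NilTwoBurnside m (G × H) := ⟨hG.1.prod hH.1, hG.2.prod hH.2⟩

theorem NilTwoBurnside.of_surjective {m : ℕ} (hG : NilTwoBurnside m G) (f : G →* H)
    (hf : Function.Surjective f) : NilTwoBurnside m H :=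
  ⟨hG.1.of_surjective f hf, hG.2.of_surjective f hf⟩

end NilTwo

/-! ### Central extensions with biadditive cocycle, and central quotients. -/

/-- A biadditive map from a group to an abelian group. -/
structure BiadditiveMap (H : Type*) (V : Type*) [Group H] [AddCommGroup V] where
  toFun : H → H → V
  map_mul_left : ∀ x y z, toFun (x * y) z = toFun x z + toFun y z
  map_mul_right : ∀ x y z, toFun x (y * z) = toFun x y + toFun x z

namespace BiadditiveMap

variable {H V : Type*} [Group H] [AddCommGroup V] (β : BiadditiveMap H V)

instance : CoeFun (BiadditiveMap H V) fun _ => H → H → V := ⟨toFun⟩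

/-- A biadditive map, with its left argument fixed. -/
def left (x : H) : H →* Multiplicative V :=
  MonoidHom.mk' (fun y => .ofAdd (β x y)) fun y z => congrArg _ (β.map_mul_right x y z)

/-- A biadditive map, with its right argument fixed. -/
def right (y : H) : H →* Multiplicative V :=
  MonoidHom.mk' (fun x => .ofAdd (β x y)) fun x z => congrArg _ (β.map_mul_left x z y)

@[simp] theorem map_one_left (y : H) : β 1 y = 0 := map_one (β.right y)
@[simp] theorem map_one_right (x : H) : β x 1 = 0 := map_one (β.left x)
@[simp] theorem map_inv_left (x y : H) : β x⁻¹ y = -β x y := map_inv (β.right y) x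
@[simp] theorem map_inv_right (x y : H) : β x y⁻¹ = -β x y := map_inv (β.left x) y

@[simp] theorem map_pow_left (x y : H) (k : ℕ) : β (x ^ k) y = k • β x y :=
  map_pow (β.right y) x k

theorem map_commutator_left (x y z : H) : β ⁅x, y⁆ z = 0 := by
  simp only [commutatorElement_def, map_mul_left, map_inv_left]; abel

theorem map_commutator_right (x y z : H) : β x ⁅y, z⁆ = 0 := by
  simp only [commutatorElement_def, map_mul_right, map_inv_right]; abel

/-- The central extension of `H` by `V` with cocycle `β`. -/
@[ext] structure Extension (β : BiadditiveMap H V) where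
  base : H
  fiber : V

namespace Extension

variable {β}

instance : Mul β.Extension := ⟨fun x y => ⟨x.base * y.base, x.fiber + y.fiber + β x.base y.base⟩⟩
instance : One β.Extension := ⟨⟨1, 0⟩⟩
-- The correction term cancels the cocycle value β(b⁻¹, b) = -β(b, b).
instance : Inv β.Extension := ⟨fun x => ⟨x.base⁻¹, -x.fiber + β x.base x.base⟩⟩

@[simp] theorem base_mul (x y : β.Extension) : (x * y).base = x.base * y.base := rfl
@[simp] theorem fiber_mul (x y : β.Extension) :
    (x * y).fiber = x.fiber + y.fiber + β x.base y.base := rfl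
@[simp] theorem base_one : (1 : β.Extension).base = 1 := rfl
@[simp] theorem fiber_one : (1 : β.Extension).fiber = 0 := rfl
@[simp] theorem base_inv (x : β.Extension) : x⁻¹.base = x.base⁻¹ := rfl
@[simp] theorem fiber_inv (x : β.Extension) : x⁻¹.fiber = -x.fiber + β x.base x.base := rfl

instance : Group β.Extension :=
  Group.ofLeftAxioms
    (fun x y z => by
      ext
      · simp [mul_assoc]
      · simp only [fiber_mul, base_mul, map_mul_left, map_mul_right]; abel)
    (fun x => by ext <;> simp)
    (fun x => by ext <;> simp)

/-- The projection of the central extension to its base. -/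
@[simps] def baseHom (β : BiadditiveMap H V) : β.Extension →* H where
  toFun := base
  map_one' := rfl
  map_mul' _ _ := rfl

/-- Elements over homomorphisms into the base along which the cocycle vanishes. -/
@[simps] def lift {G : Type*} [Group G] (f : G →* H) (hf : ∀ x y, β (f x) (f y) = 0) :
    G →* β.Extension where
  toFun x := ⟨f x, 0⟩
  map_one' := by ext <;> simp
  map_mul' x y := by ext <;> simp [hf]

theorem base_commutator (x y : β.Extension) : ⁅x, y⁆.base = ⁅x.base, y.base⁆ := rfl

theorem fiber_commutator (x y : β.Extension) :
    ⁅x, y⁆.fiber = β x.base y.base - β y.base x.base := by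
  simp only [commutatorElement_def, fiber_mul, fiber_inv, base_mul, base_inv, map_mul_left,
    map_inv_left, map_inv_right]
  abel

theorem commute_iff {x y : β.Extension} :
    Commute x y ↔ Commute x.base y.base ∧ β x.base y.base = β y.base x.base := by
  simp only [commute_iff_eq, Extension.ext_iff, base_mul, fiber_mul, add_comm x.fiber,
    add_right_inj]

theorem fiber_pow (x : β.Extension) (m : ℕ) :
    (x ^ m).base = x.base ^ m ∧
      (x ^ m).fiber = m • x.fiber + (m * (m - 1) / 2) • β x.base x.base := by
  refine ⟨map_pow (baseHom β) x m, ?_⟩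
  rw [← Nat.choose_two_right]
  induction m with
  | zero => simp
  | succ m ih =>
    rw [pow_succ, fiber_mul, ih, show (x ^ m).base = x.base ^ m from map_pow (baseHom β) x m,
      map_pow_left, Nat.choose_succ_succ, Nat.choose_one_right, add_smul, add_smul, one_smul]
    abel

/-- The fibre of an `m`-th power involves β(b, b) with coefficient m(m - 1)/2, a multiple of `m` for
odd `m`. This is where oddness enters. -/
theorem burnside {H : Type u} {V : Type v} [Group H] [AddCommGroup V] (β : BiadditiveMap H V) {m : ℕ}
    (hm : Odd m) (hH : Burnside m H) (hV : ∀ v : V, m • v = 0) : Burnside m β.Extension := by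
  intro x
  obtain ⟨h₁, h₂⟩ := fiber_pow x m
  ext
  · rw [h₁, hH]; rfl
  · obtain ⟨k, rfl⟩ := hm
    rw [h₂, hV, zero_add, add_tsub_cancel_right, mul_left_comm, Nat.mul_div_cancel_left _ two_pos,
      mul_smul, hV]
    rfl

/-- A biadditive map to an abelian group vanishes when either argument is a commutator. -/
theorem nilTwo {H : Type u} {V : Type v} [Group H] [AddCommGroup V] (β : BiadditiveMap H V)
    (hH : NilTwo H) : NilTwo β.Extension :=
  nilTwo_iff.2 fun x y z => by
    rw [commute_iff, base_commutator, map_commutator_left, map_commutator_right]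
    exact ⟨hH.commute _ _ _, rfl⟩

end Extension

end BiadditiveMap

/-- A family of elements of a group which is multiplicative and central modulo a central subgroup
generates, together with this subgroup, a normal subgroup. -/
theorem exists_normal_of_mul_mem {X F : Type*} [Group X] [Group F] (K : Subgroup F)
    (hK : K ≤ Subgroup.center F) (n : X → F)
    (hmul : ∀ x y, ∃ k ∈ K, n x * n y = n (x * y) * k)
    (hcomm : ∀ x f, ∃ k ∈ K, n x * f = f * n x * k) :
    ∃ N : Subgroup F, N.Normal ∧ ∀ f, f ∈ N ↔ ∃ x, ∃ k ∈ K, n x * k = f := by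
  have : K.Normal := ⟨fun k hk g => by
    rw [Subgroup.mem_center_iff.1 (hK hk) g, mul_inv_cancel_right]; exact hk⟩
  let π := QuotientGroup.mk' K
  have hπ : ∀ k ∈ K, π k = 1 := fun k hk => (QuotientGroup.eq_one_iff k).2 hk
  -- Modulo `K` the family is a homomorphism with central range; the required subgroup is the
  -- preimage of that range.
  let ν : X →* F ⧸ K := MonoidHom.mk' (fun x => π (n x)) fun x y => by
    obtain ⟨k, hk, h⟩ := hmul x y
    rw [← map_mul, h, map_mul, hπ k hk, mul_one]
  have hν : ν.range ≤ Subgroup.center (F ⧸ K) := by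
    rintro _ ⟨x, rfl⟩
    refine Subgroup.mem_center_iff.2 fun g => ?_
    obtain ⟨f, rfl⟩ := QuotientGroup.mk'_surjective K g
    obtain ⟨k, hk, h⟩ := hcomm x f
    change π f * π (n x) = π (n x) * π f
    rw [← map_mul, ← map_mul, h, map_mul π (f * n x) k, hπ k hk, mul_one]
  have : ν.range.Normal := ⟨fun k hk g => by
    rw [Subgroup.mem_center_iff.1 (hν hk) g, mul_inv_cancel_right]; exact hk⟩
  refine ⟨ν.range.comap π, inferInstance, fun f => ?_⟩
  constructor
  · rintro ⟨x, hx⟩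
    exact ⟨x, (n x)⁻¹ * f, QuotientGroup.eq.1 hx, by group⟩
  · rintro ⟨x, k, hk, rfl⟩
    exact ⟨x, by rw [map_mul, hπ k hk, mul_one]; rfl⟩

/-! ### Overgroups of exponent `m`, and how weak embeddability forces purity. -/

section Overgroups

variable {G : Type u} [Group G]

theorem burnside_abelianization {m : ℕ} (hG : Burnside m G) (v : Additive (Abelianization G)) :
    m • v = 0 := by
  obtain ⟨x, hx⟩ := QuotientGroup.mk_surjective v.toMul
  change v.toMul ^ m = 1
  rw [← hx]
  change Abelianization.of x ^ m = 1
  rw [← map_pow, hG, map_one]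

theorem abelianization_of_eq_one_iff {x : G} : Abelianization.of x = 1 ↔ x ∈ commutator G :=
  QuotientGroup.eq_one_iff x

/-- The biadditive map on `G × ZMod d` with `((x, i), (y, j)) ↦ i • π y`. -/
noncomputable def zmodPairing {V : Type*} [AddCommGroup V] {d : ℕ} (hV : ∀ v : V, d • v = 0)
    (π : G →* Multiplicative V) : BiadditiveMap (G × Multiplicative (ZMod d)) V where
  toFun x y := ZMod.lift d (⟨zmultiplesHom (V →+ V) (AddMonoidHom.id V), by
    ext v; simpa using hV v⟩ : {f : ℤ →+ (V →+ V) // f d = 0}) x.2.toAdd (π y.1).toAdd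
  map_mul_left x y z := by simp
  map_mul_right x y z := by simp

section

variable {V : Type*} [AddCommGroup V] {d : ℕ} (hV : ∀ v : V, d • v = 0)
  (π : G →* Multiplicative V)

@[simp] theorem zmodPairing_intCast (x y : G) (i : ℤ) (j : Multiplicative (ZMod d)) :
    zmodPairing hV π (x, .ofAdd (i : ZMod d)) (y, j) = i • (π y).toAdd := by
  simp [zmodPairing]

@[simp] theorem zmodPairing_one (x : G) (y : G × Multiplicative (ZMod d)) :
    zmodPairing hV π (x, 1) y = 0 := by
  simp [zmodPairing]

@[simp] theorem zmodPairing_ofAdd_one (x y : G) (j : Multiplicative (ZMod d)) :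
    zmodPairing hV π (x, .ofAdd 1) (y, j) = (π y).toAdd := by
  simpa using zmodPairing_intCast hV π x y 1 j

theorem zmodPairing_of_eq_one (x y : G × Multiplicative (ZMod d)) (h : π y.1 = 1) :
    zmodPairing hV π x y = 0 := by
  simp [zmodPairing, h]

/-- The central extension of `G × ZMod d` given by `zmodPairing`. -/
abbrev ZModExtension := (zmodPairing hV π).Extension

/-- The embedding of `G` in the central extension of `G × ZMod d` given by `zmodPairing`. -/
noncomputable def zmodExtensionHom : G →* ZModExtension hV π :=
  BiadditiveMap.Extension.lift (MonoidHom.inl G _) fun x y => by simp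

theorem nilTwoBurnside_zmodExtension {V : Type v} [AddCommGroup V] {d m : ℕ}
    (hV : ∀ v : V, d • v = 0) (π : G →* Multiplicative V) (hm : Odd m) (hd : d ∣ m)
    (hG : NilTwoBurnside m G) : NilTwoBurnside m (ZModExtension hV π) := by
  obtain ⟨k, rfl⟩ := hd
  refine ⟨BiadditiveMap.Extension.nilTwo _ (hG.1.prod (nilTwo_of_commGroup _)),
    BiadditiveMap.Extension.burnside _ hm (hG.2.prod fun x => ?_) fun v => ?_⟩
  · change (d * k) • x.toAdd = 0
    simp
  · rw [mul_comm, mul_smul, hV, smul_zero]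

end

/-- The Heisenberg group over `ZMod m`. -/
abbrev Heisenberg (m : ℕ) :=
  ZModExtension (by simp : ∀ v : ZMod m, m • v = 0) (MonoidHom.id (Multiplicative (ZMod m)))

/-- An element which is not a `q`-th power modulo the commutator subgroup fails to commute with an
element of order dividing `q` in a suitable overgroup. -/
theorem exists_overgroup_not_commute {m : ℕ} (hm : Odd m) (hG : NilTwoBurnside m G) (q : ℕ) (g : G)
    (hg : ¬ ∃ x, ∃ z ∈ commutator G, g = x ^ q * z) :
    ∃ (C : Type u) (_ : Group C) (j : G →* C) (c : C), NilTwoBurnside m C ∧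
      Function.Injective j ∧ c ^ q = 1 ∧ ⁅j g, c⁆ ≠ 1 := by
  let B := Additive (Abelianization G)
  let D := (nsmulAddMonoidHom q : B →+ B).range
  let π : G →* Multiplicative (B ⧸ D) :=
    (AddMonoidHom.toMultiplicativeRight (QuotientAddGroup.mk' D)).comp Abelianization.of
  -- The cyclic factor has order gcd(q, m): dividing `m` preserves the exponent, dividing `q` makes
  -- its generator `c` satisfy c^q = 1. Commutators with `c` are given by ±`π`, which is nontrivial
  -- at `g`.
  have hV : ∀ v : B ⧸ D, q.gcd m • v = 0 := by
    intro v
    rw [← addOrderOf_dvd_iff_nsmul_eq_zero, Nat.dvd_gcd_iff, addOrderOf_dvd_iff_nsmul_eq_zero,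
      addOrderOf_dvd_iff_nsmul_eq_zero]
    obtain ⟨v, rfl⟩ := QuotientAddGroup.mk'_surjective D v
    rw [← map_nsmul, ← map_nsmul, burnside_abelianization hG.2, map_zero]
    exact ⟨(QuotientAddGroup.eq_zero_iff _).2 ⟨v, rfl⟩, rfl⟩
  refine ⟨ZModExtension hV π, inferInstance, zmodExtensionHom hV π,
    ⟨(1, .ofAdd 1), 0⟩, nilTwoBurnside_zmodExtension hV π hm (Nat.gcd_dvd_right q m) hG,
    fun x y h => congrArg (fun z => z.base.1) h, ?_, ?_⟩
  · ext : 1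
    · rw [(BiadditiveMap.Extension.fiber_pow _ _).1]
      refine Prod.ext (one_pow q) ?_
      change q • (1 : ZMod (q.gcd m)) = 0
      rw [nsmul_one, ZMod.natCast_eq_zero_iff]
      exact Nat.gcd_dvd_left q m
    · rw [(BiadditiveMap.Extension.fiber_pow _ _).2]
      simp
  · intro h
    have h' := congrArg BiadditiveMap.Extension.fiber h
    rw [BiadditiveMap.Extension.fiber_commutator] at h'
    have h0 : (π g).toAdd = 0 := by simpa [zmodExtensionHom] using h'
    obtain ⟨b, hb⟩ := (QuotientAddGroup.eq_zero_iff _).1 h0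
    obtain ⟨x, hx⟩ := QuotientGroup.mk_surjective b.toMul
    refine hg ⟨x, (x ^ q)⁻¹ * g, ?_, by group⟩
    rw [← abelianization_of_eq_one_iff, map_mul, map_inv, inv_mul_eq_one, map_pow]
    change b.toMul ^ q = Abelianization.of g at hb
    rw [← hb, ← hx]
    rfl

/-- Adjoining a `q`-th root modulo the commutator subgroup, the commutators with this root being
given by a quotient of the abelianization. -/
theorem exists_overgroup_of_quotient {m : ℕ} (hm : Odd m) (hG : NilTwoBurnside m G) (q : ℕ) (g : G)
    {V : Type u} [AddCommGroup V] (hV : ∀ v : V, m • v = 0) (π : G →* Multiplicative V)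
    (hπg : π g = 1) (hg : ∀ y : G, q • (π y).toAdd = 0 → Commute y g) :
    ∃ (A : Type u) (_ : Group A) (i : G →* A) (a s : A), NilTwoBurnside m A ∧
      Function.Injective i ∧ s ∈ commutator A ∧ i g = a ^ q * s := by
  have hπ' : ∀ x y : G, π ⁅x, y⁆ = 1 := by simp [commutatorElement_eq_one_iff_commute, Commute.all]
  have hE : NilTwoBurnside m (ZModExtension hV π) := nilTwoBurnside_zmodExtension hV π hm dvd_rfl hG
  have hT : NilTwoBurnside m (Heisenberg m) := nilTwoBurnside_zmodExtension _ _ hm dvd_rfl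
    ⟨nilTwo_of_commGroup _, fun x => by change m • x.toAdd = 0; simp⟩
  have hF : NilTwoBurnside m (ZModExtension hV π × Heisenberg m) := hE.prod hT
  -- `κ h` is the commutator of `h` with the relator `e` below, so it dies together with `e`.
  let κ : G →* ZModExtension hV π × Heisenberg m := MonoidHom.mk' (fun h => (⟨(⁅g, h⁆, 1), -(q • (π h).toAdd)⟩, 1))
    fun x y => Prod.ext (BiadditiveMap.Extension.ext
        (Prod.ext (hG.1.commutatorElement_mul_right g x y) (one_mul 1).symm) (by
          simp only [map_mul, toAdd_mul, smul_add, neg_add, Prod.fst_mul, BiadditiveMap.Extension.fiber_mul,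
            zmodPairing_one, add_zero])) (one_mul 1).symm
  -- A central commutator of order `m` in a separate factor: it marks the powers of `e`, so that
  -- only trivial ones can meet `G`.
  let t : Heisenberg m := ⟨1, 1⟩
  let e : ZModExtension hV π × Heisenberg m := (⟨(g, .ofAdd ((-q : ℤ) : ZMod m)), 0⟩, t)
  have htc : ∀ x : Heisenberg m, Commute t x := fun x => by
    rw [BiadditiveMap.Extension.commute_iff]
    exact ⟨Commute.all _ _, by simp [t]⟩
  have hκ : κ.range ≤ Subgroup.center (ZModExtension hV π × Heisenberg m) := by
    rintro _ ⟨x, rfl⟩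
    refine Subgroup.mem_center_iff.2 fun y => Commute.symm (Prod.ext (Commute.eq ?_) ?_)
    · rw [BiadditiveMap.Extension.commute_iff]
      refine ⟨Prod.ext (hG.1.commute _ _ _).eq (mul_comm _ _), ?_⟩
      exact (zmodPairing_one hV π _ _).trans (zmodPairing_of_eq_one hV π _ _ (hπ' _ _)).symm
    · exact (Commute.one_left y.2).eq
  have hcomm : ∀ f : ZModExtension hV π × Heisenberg m, ⁅e, f⁆ = κ f.1.base.1 := by
    intro f
    refine Prod.ext (BiadditiveMap.Extension.ext ?_ ?_) ?_
    · exact Prod.ext rfl (commutatorElement_eq_one_iff_commute.2 (Commute.all _ _))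
    · refine (BiadditiveMap.Extension.fiber_commutator _ _).trans ?_
      change zmodPairing hV π (g, .ofAdd ((-q : ℤ) : ZMod m)) (f.1.base.1, f.1.base.2) -
        zmodPairing hV π f.1.base (g, _) = -(q • (π f.1.base.1).toAdd)
      rw [zmodPairing_of_eq_one hV π _ (g, _) hπg, zmodPairing_intCast, sub_zero, neg_smul,
        natCast_zsmul]
    · exact commutatorElement_eq_one_iff_commute.2 (htc _)
  obtain ⟨N, hN, hmem⟩ := exists_normal_of_mul_mem κ.range hκ
    (fun i : Multiplicative ℤ => e ^ i.toAdd)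
    (fun x y => ⟨1, one_mem _, by rw [mul_one]; exact (zpow_add e _ _).symm⟩)
    (fun x f => ⟨⁅e ^ x.toAdd, f⁆, by
      rw [← commutatorElement_inv, hF.1.commutatorElement_zpow_right, ← inv_zpow,
        commutatorElement_inv, hcomm]
      exact zpow_mem (MonoidHom.mem_range.2 ⟨_, rfl⟩) _, by
      rw [← (hF.1.commute (e ^ x.toAdd) f _).eq, commutatorElement_def]; group⟩)
  let ι : G →* ZModExtension hV π × Heisenberg m := (MonoidHom.inl _ _).comp (zmodExtensionHom hV π)
  let a : ZModExtension hV π × Heisenberg m := (⟨(1, .ofAdd 1), 0⟩, 1)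
  have ha : a ^ q = (⟨(1, .ofAdd ((q : ℤ) : ZMod m)), 0⟩, 1) := by
    refine Prod.ext (BiadditiveMap.Extension.ext ?_ ?_) (one_pow q)
    · refine (BiadditiveMap.Extension.fiber_pow _ _).1.trans (Prod.ext (one_pow q) ?_)
      change q • (1 : ZMod m) = ((q : ℤ) : ZMod m)
      simp
    · refine (BiadditiveMap.Extension.fiber_pow _ _).2.trans ?_
      simp [a]
  have htcomm : t⁻¹ ∈ commutator (Heisenberg m) := by
    have : t = ⁅(⟨(1, .ofAdd 1), 0⟩ : Heisenberg m), ⟨(.ofAdd 1, 1), 0⟩⁆ := by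
      refine BiadditiveMap.Extension.ext ?_ ?_
      · exact (commutatorElement_eq_one_iff_commute.2 (Commute.all _ _)).symm
      · rw [BiadditiveMap.Extension.fiber_commutator]
        simp [t]
    rw [this]
    exact inv_mem (Subgroup.commutator_mem_commutator trivial trivial)
  -- Killing `e` thus makes `g` a q-th power times a commutator; `π g = 1` removes the cocycle term.
  have key : ι g = a ^ q * (1, t⁻¹) * e := by
    rw [ha]
    refine Prod.ext (BiadditiveMap.Extension.ext (Prod.ext ?_ ?_) ?_) ?_
    · simp [ι, e, zmodExtensionHom]
    · simp [ι, e, zmodExtensionHom]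
    · have := zmodPairing_of_eq_one hV π (1, .ofAdd ((q : ℤ) : ZMod m))
        (g, .ofAdd ((-q : ℤ) : ZMod m)) hπg
      simp only [Int.cast_natCast, Int.cast_neg, ofAdd_neg] at this
      simp [ι, e, zmodExtensionHom, this]
    · simp [ι, e]
  refine ⟨(ZModExtension hV π × Heisenberg m) ⧸ N, inferInstance, (QuotientGroup.mk' N).comp ι, QuotientGroup.mk' N a,
    QuotientGroup.mk' N (1, t⁻¹), hF.of_surjective _ (QuotientGroup.mk'_surjective N), ?_,
    map_mem_commutator _ (map_mem_commutator (MonoidHom.inr (ZModExtension hV π) (Heisenberg m)) htcomm),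
    ?_⟩
  · rw [injective_iff_map_eq_one]
    intro x hx
    obtain ⟨i, _, ⟨y, rfl⟩, h⟩ := (hmem _).1 ((QuotientGroup.eq_one_iff _).1 hx)
    have h2 : t ^ i.toAdd = 1 := by simpa [κ, e, ι] using congrArg Prod.snd h
    have hdvd : (m : ℤ) ∣ i.toAdd := by
      let τ : Multiplicative (ZMod m) →* (Heisenberg m) := MonoidHom.mk' (fun z => ⟨1, z.toAdd⟩) fun x y =>
        BiadditiveMap.Extension.ext (one_mul 1).symm (by simp)
      have : τ (.ofAdd (i.toAdd • (1 : ZMod m))) = t ^ i.toAdd := map_zpow τ (.ofAdd 1) _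
      rw [h2] at this
      have := congrArg BiadditiveMap.Extension.fiber this
      rw [← ZMod.intCast_zmod_eq_zero_iff_dvd]
      simpa [τ] using this
    have he : e ^ i.toAdd = 1 := by
      obtain ⟨k, hk⟩ := hdvd
      rw [hk, zpow_mul, zpow_natCast, hF.2, one_zpow]
    rw [he, one_mul] at h
    have h3 : ⁅g, y⁆ = x := congrArg (fun z => z.1.base.1) h
    have h4 : -(q • (π y).toAdd) = 0 := congrArg (fun z => z.1.fiber) h
    rw [← h3, commutatorElement_eq_one_iff_commute]
    exact (hg y (neg_eq_zero.1 h4)).symm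
  · change QuotientGroup.mk' N (ι g) = _
    have he : QuotientGroup.mk' N e = 1 := (QuotientGroup.eq_one_iff e).2
      ((hmem e).2 ⟨.ofAdd 1, 1, one_mem _, by simp⟩)
    rw [key, map_mul, map_mul, map_pow, he, mul_one]

/-- Adjoining a `q`-th root modulo the commutator subgroup. -/
theorem exists_overgroup_eq_pow_mul {m : ℕ} (hm : Odd m) (hG : NilTwoBurnside m G) (q : ℕ) (g : G)
    (hg : ∀ (y : G) (k : ℤ), y ^ q * g ^ k ∈ commutator G → Commute y g) :
    ∃ (A : Type u) (_ : Group A) (i : G →* A) (a s : A), NilTwoBurnside m A ∧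
      Function.Injective i ∧ s ∈ commutator A ∧ i g = a ^ q * s := by
  let B := Additive (Abelianization G)
  -- Commutation with the root must kill `g`. Killing nothing more keeps the condition on `y`
  -- weakest: q • π y = 0 means y^q ∈ ⟨g⟩[G, G].
  let D := AddSubgroup.zmultiples (Additive.ofMul (Abelianization.of g) : B)
  let π : G →* Multiplicative (B ⧸ D) :=
    (AddMonoidHom.toMultiplicativeRight (QuotientAddGroup.mk' D)).comp Abelianization.of
  refine exists_overgroup_of_quotient hm hG q g (V := B ⧸ D) (fun v => ?_) π
    ((QuotientAddGroup.eq_zero_iff _).2 (AddSubgroup.mem_zmultiples _)) fun y hy => ?_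
  · obtain ⟨v, rfl⟩ := QuotientAddGroup.mk'_surjective D v
    rw [← map_nsmul, burnside_abelianization hG.2, map_zero]
  · have h : Additive.ofMul (Abelianization.of (y ^ q)) ∈ D := by
      rw [← QuotientAddGroup.eq_zero_iff, map_pow]
      exact hy
    obtain ⟨k, hk⟩ := h
    refine hg y (-k) ?_
    rw [← abelianization_of_eq_one_iff, map_mul, zpow_neg, map_inv, mul_inv_eq_one, map_zpow]
    exact hk.symm

/-- If all amalgams of groups in `N₂ ∩ B_m` with core `G` embed weakly in an `N₂`-group, then every
element of `G` with a `q`-th root modulo commutators in an `N₂`-overgroup has one in `G`. -/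
theorem exists_eq_pow_mul_of_weaklyEmbeddable {m : ℕ} (hm : Odd m) (hG : NilTwoBurnside m G)
    (H : ∀ 𝒜 : Amalgam G, 𝒜.Of (NilTwoBurnside m) → 𝒜.WeaklyEmbeddable NilTwo)
    {A : Type u} [Group A] (hA : NilTwo A) (i : G →* A) (hi : Function.Injective i) (q : ℕ) (g : G)
    (a s : A) (hs : s ∈ commutator A) (h : i g = a ^ q * s) :
    ∃ x, ∃ z ∈ commutator G, g = x ^ q * z := by
  by_contra hg
  -- Since `a` commutes with `g` and with y^q g^k, also [a, y]^q = 1, whence [y, g] = [y, a]^q = 1.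
  have hcomm : ∀ (y : G) (k : ℤ), y ^ q * g ^ k ∈ commutator G → Commute y g := by
    intro y k hy
    have h1 : ∀ b : A, ⁅b, i g⁆ = ⁅b, a⁆ ^ q := fun b => by
      rw [h, hA.commutatorElement_mul_right, hA.commutatorElement_pow_right,
        commutatorElement_eq_one_iff_commute.2 (hA.commute_of_mem hs b).symm, mul_one]
    have h2 : ⁅a, i g⁆ = 1 := by rw [h1, commutatorElement_self, one_pow]
    have h3 : ⁅a, i (y ^ q * g ^ k)⁆ = 1 := commutatorElement_eq_one_iff_commute.2
      (hA.commute_of_mem (map_mem_commutator i hy) a).symm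
    rw [map_mul, hA.commutatorElement_mul_right, map_zpow, hA.commutatorElement_zpow_right, h2,
      one_zpow, mul_one, map_pow, hA.commutatorElement_pow_right] at h3
    rw [← commutatorElement_eq_one_iff_commute]
    apply hi
    rw [map_commutatorElement, h1, map_one, ← commutatorElement_inv, inv_pow, h3, inv_one]
  obtain ⟨C, _, j, c, hC, hj, hc, hne⟩ := exists_overgroup_not_commute hm hG q g hg
  obtain ⟨A', _, i', a', s', hA', hi', hs', h'⟩ := exists_overgroup_eq_pow_mul hm hG q g hcomm
  obtain ⟨M, _, hM, ⟨f⟩⟩ := H ⟨A', C, i', j, hi', hj⟩ ⟨hG, hA', hC⟩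
  let fl : A' →* M := f.left
  let fr : C →* M := f.right
  have e1 : fl (i' g) = fr (j g) :=
    DFunLike.congr_fun (f.left_comp.trans f.right_comp.symm) g
  -- In `M`: [g, c] = [a' ^ q s', c] = [a', c]^q = [a', c^q] = 1.
  apply hne
  apply f.right_injective
  change fr _ = fr 1
  rw [map_commutatorElement, ← e1, h', map_mul, hM.commutatorElement_mul_left,
    commutatorElement_eq_one_iff_commute.2 (hM.commute_of_mem (map_mem_commutator fl hs') (fr c)),
    mul_one, map_pow, hM.commutatorElement_pow_left, ← hM.commutatorElement_pow_right, ← map_pow,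
    hc, map_one, commutatorElement_one_right]

end Overgroups

/-! ### Abelianizations in additive notation. -/

section AbClass

variable {G A : Type*} [Group G] [Group A]

/-- The class of an element in the abelianization, written additively. -/
def abClass (x : G) : Additive (Abelianization G) := .ofMul (Abelianization.of x)

theorem abClass_surjective : Function.Surjective (abClass : G → _) :=
  QuotientGroup.mk_surjective

@[simp] theorem abClass_one : abClass (1 : G) = 0 := rfl
@[simp] theorem abClass_mul (x y : G) : abClass (x * y) = abClass x + abClass y := rfl
@[simp] theorem abClass_inv (x : G) : abClass x⁻¹ = -abClass x := rfl
@[simp] theorem abClass_pow (x : G) (q : ℕ) : abClass (x ^ q) = q • abClass x := rfl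

theorem abClass_eq_zero_iff {x : G} : abClass x = 0 ↔ x ∈ commutator G :=
  abelianization_of_eq_one_iff

/-- Functoriality of the abelianization, written additively. -/
def abMap (f : G →* A) : Additive (Abelianization G) →ₗ[ℤ] Additive (Abelianization A) :=
  (MonoidHom.toAdditive (Abelianization.map f)).toIntLinearMap

@[simp] theorem abMap_abClass (f : G →* A) (x : G) : abMap f (abClass x) = abClass (f x) := rfl

theorem pureMono_abMap {f : G →* A} (hf : ∀ (q : ℕ) (g : G) (a s : A), s ∈ commutator A →
    f g = a ^ q * s → ∃ x, ∃ z ∈ commutator G, g = x ^ q * z) : PureMono (abMap f) := by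
  intro q r x h
  obtain ⟨g, rfl⟩ := abClass_surjective r
  obtain ⟨a, rfl⟩ := abClass_surjective x
  obtain ⟨y, z, hz, rfl⟩ := hf q g a ((a ^ q)⁻¹ * f g)
    (abClass_eq_zero_iff.1 (by
      rw [abClass_mul, abClass_inv, abClass_pow, ← h, abMap_abClass, neg_add_cancel])) (by group)
  exact ⟨abClass y, by rw [abClass_mul, abClass_eq_zero_iff.2 hz, add_zero, abClass_pow]⟩

end AbClass

/-! ### The amalgamated coproduct in class two. -/

section Amalgamation

variable {G A C : Type u} [Group G] [Group A] [Group C]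

/-- The commutator map of a group of class at most two, as a homomorphism on the tensor square of
the abelianization. -/
noncomputable def NilTwo.commutatorTensor (h : NilTwo G) :
    Additive (Abelianization G) ⊗[ℤ] Additive (Abelianization G) →+
      Additive (Subgroup.center G) :=
  let f₁ : Abelianization G →* Abelianization G →* Subgroup.center G :=
    Abelianization.lift (MonoidHom.mk' (fun x => Abelianization.lift (h.commutatorHom x))
      fun x y => by
        ext z
        exact h.commutatorElement_mul_left x y z)
  let f₂ : Additive (Abelianization G) →+ Additive (Abelianization G) →+
      Additive (Subgroup.center G) :=
    AddMonoidHom.mk' (fun x => MonoidHom.toAdditive (f₁ x.toMul)) fun x y => by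
      ext z
      simp
  TensorProduct.liftAddHom f₂ fun r x y => by
    rw [map_zsmul, map_zsmul]; rfl

/-- The value of `NilTwo.commutatorTensor` as an element of the group. -/
noncomputable def NilTwo.commutatorValue (h : NilTwo G)
    (t : Additive (Abelianization G) ⊗[ℤ] Additive (Abelianization G)) : G :=
  (h.commutatorTensor t).toMul

theorem NilTwo.commutatorValue_tmul (h : NilTwo G) (x y : G) :
    h.commutatorValue (abClass x ⊗ₜ abClass y) = ⁅x, y⁆ := rfl

theorem NilTwo.commutatorValue_add (h : NilTwo G)
    (s t : Additive (Abelianization G) ⊗[ℤ] Additive (Abelianization G)) :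
    h.commutatorValue (s + t) = h.commutatorValue s * h.commutatorValue t := by
  simp [commutatorValue]

theorem NilTwo.commutatorValue_zero (h : NilTwo G) : h.commutatorValue 0 = 1 := by
  simp [commutatorValue]

theorem NilTwo.commutatorValue_neg (h : NilTwo G)
    (t : Additive (Abelianization G) ⊗[ℤ] Additive (Abelianization G)) :
    h.commutatorValue (-t) = (h.commutatorValue t)⁻¹ := by
  simp [commutatorValue]

theorem NilTwo.commutatorValue_mem (h : NilTwo G)
    (t : Additive (Abelianization G) ⊗[ℤ] Additive (Abelianization G)) :
    h.commutatorValue t ∈ commutator G := by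
  induction t with
  | zero => rw [h.commutatorValue_zero]; exact one_mem _
  | tmul x y =>
    obtain ⟨x, rfl⟩ := abClass_surjective x
    obtain ⟨y, rfl⟩ := abClass_surjective y
    rw [h.commutatorValue_tmul]
    exact Subgroup.commutator_mem_commutator trivial trivial
  | add s t hs ht => rw [h.commutatorValue_add]; exact mul_mem hs ht

theorem NilTwo.commutatorValue_map (hG : NilTwo G) (hA : NilTwo A) (f : G →* A)
    (t : Additive (Abelianization G) ⊗[ℤ] Additive (Abelianization G)) :
    hA.commutatorValue (TensorProduct.map (abMap f) (abMap f) t) = f (hG.commutatorValue t) := by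
  induction t with
  | zero => rw [map_zero, commutatorValue_zero, commutatorValue_zero, map_one]
  | tmul x y =>
    obtain ⟨x, rfl⟩ := abClass_surjective x
    obtain ⟨y, rfl⟩ := abClass_surjective y
    rw [TensorProduct.map_tmul, abMap_abClass, abMap_abClass, commutatorValue_tmul,
      commutatorValue_tmul, map_commutatorElement]
  | add s t hs ht => rw [map_add, commutatorValue_add, hs, ht, commutatorValue_add, map_mul]

/-- The cocycle of the coproduct of `A` and `C` among groups of class at most two. -/
noncomputable def coproductPairing (A C : Type u) [Group A] [Group C] :
    BiadditiveMap (A × C) (Additive (Abelianization A) ⊗[ℤ] Additive (Abelianization C)) where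
  toFun x y := abClass x.1 ⊗ₜ abClass y.2
  map_mul_left x y z := by simp [TensorProduct.add_tmul]
  map_mul_right x y z := by simp [TensorProduct.tmul_add]

theorem coproductPairing_apply (x y : A × C) :
    coproductPairing A C x y = abClass x.1 ⊗ₜ abClass y.2 := rfl

/-- The coproduct of `A` and `C` among groups of class at most two. -/
abbrev NilTwoCoproduct (A C : Type u) [Group A] [Group C] := (coproductPairing A C).Extension

/-- In the amalgamated coproduct, the commutator of `a : A` with `g : G` may be computed in `A` and
in `[A, C]`, and likewise for the commutators of `g : G` with `c : C`. This is the resulting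
homomorphism of relators. -/
noncomputable def commutatorRelator (hA : NilTwo A) (hC : NilTwo C) (i : G →* A) (j : G →* C) :
    Multiplicative ((Additive (Abelianization A) ⊗[ℤ] Additive (Abelianization G)) ×
      (Additive (Abelianization G) ⊗[ℤ] Additive (Abelianization C))) →* NilTwoCoproduct A C :=
  MonoidHom.mk' (fun t =>
    ⟨(hA.commutatorValue ((abMap i).lTensor _ t.toAdd.1),
      hC.commutatorValue ((abMap j).rTensor _ t.toAdd.2)),
      -((abMap j).lTensor _ t.toAdd.1) - (abMap i).rTensor _ t.toAdd.2⟩) fun s t => by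
    refine BiadditiveMap.Extension.ext (Prod.ext ?_ ?_) ?_
    · exact (congrArg _ (map_add _ _ _)).trans (hA.commutatorValue_add _ _)
    · exact (congrArg _ (map_add _ _ _)).trans (hC.commutatorValue_add _ _)
    · rw [BiadditiveMap.Extension.fiber_mul, coproductPairing_apply,
        abClass_eq_zero_iff.2 (hC.commutatorValue_mem _), TensorProduct.tmul_zero, add_zero,
        toAdd_mul, Prod.fst_add, Prod.snd_add, map_add ((abMap j).lTensor _),
        map_add ((abMap i).rTensor _)]
      have h : ∀ a b c d : Additive (Abelianization A) ⊗[ℤ] Additive (Abelianization C),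
          -(a + b) - (c + d) = -a - c + (-b - d) := fun _ _ _ _ => by abel
      exact h _ _ _ _

/-- An amalgam of groups of class at most two is strongly embeddable if the abelianization of the
core is pure in the abelianizations of both factors. -/
theorem exists_strong_embedding (hG : NilTwo G) (hA : NilTwo A) (hC : NilTwo C) (i : G →* A)
    (j : G →* C) (hi : PureMono (abMap i)) (hj : PureMono (abMap j)) :
    ∃ (M : Type u) (_ : Group M) (l : A →* M) (r : C →* M), NilTwo M ∧
      (∀ g, l (i g) = r (j g)) ∧ ∀ a c, l a = r c → ∃ g, i g = a ∧ j g = c := by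
  let κ := commutatorRelator hA hC i j
  have hF : NilTwo (NilTwoCoproduct A C) := BiadditiveMap.Extension.nilTwo _ (hA.prod hC)
  have hκ : κ.range ≤ Subgroup.center (NilTwoCoproduct A C) := by
    rintro _ ⟨t, rfl⟩
    refine Subgroup.mem_center_iff.2 fun y => Commute.symm ?_
    rw [BiadditiveMap.Extension.commute_iff]
    refine ⟨Prod.ext (hA.commute_of_mem (hA.commutatorValue_mem _) _).eq
      (hC.commute_of_mem (hC.commutatorValue_mem _) _).eq, ?_⟩
    change abClass (hA.commutatorValue _) ⊗ₜ _ = _ ⊗ₜ abClass (hC.commutatorValue _)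
    rw [abClass_eq_zero_iff.2 (hA.commutatorValue_mem _),
      abClass_eq_zero_iff.2 (hC.commutatorValue_mem _), TensorProduct.zero_tmul,
      TensorProduct.tmul_zero]
  -- The element i(g) j(g)⁻¹ computed in the coproduct, with its cocycle term.
  let ν : G → NilTwoCoproduct A C := fun g =>
    ⟨(i g, (j g)⁻¹), -(abClass (i g) ⊗ₜ abClass (j g))⟩
  have hκapply : ∀ x y, κ (.ofAdd (x, y)) =
      ⟨(hA.commutatorValue ((abMap i).lTensor _ x), hC.commutatorValue ((abMap j).rTensor _ y)),
        -((abMap j).lTensor _ x) - (abMap i).rTensor _ y⟩ := fun _ _ => rfl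
  -- The defect comes from moving `h` in `A` past `g` in `C`, and is the relator for that
  -- commutator.
  have hmul : ∀ g h, ∃ k ∈ κ.range, ν g * ν h = ν (g * h) * k := by
    intro g h
    refine ⟨κ (.ofAdd (0, -(abClass h ⊗ₜ abClass (j g)))), ⟨_, rfl⟩, ?_⟩
    rw [hκapply]
    simp only [map_zero, map_neg, LinearMap.rTensor_tmul, abMap_abClass, hA.commutatorValue_zero,
      hC.commutatorValue_neg, hC.commutatorValue_tmul]
    refine BiadditiveMap.Extension.ext (Prod.ext ?_ ?_) ?_
    · simp [ν]
    · simp [ν, commutatorElement_def, mul_assoc]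
    · simp only [ν, BiadditiveMap.Extension.fiber_mul, coproductPairing_apply, map_mul,
        abClass_mul, abClass_inv, TensorProduct.add_tmul, TensorProduct.tmul_add,
        TensorProduct.tmul_neg, commutatorElement_def]
      abel
  have hcomm : ∀ g f, ∃ k ∈ κ.range, ν g * f = f * ν g * k := by
    intro g f
    refine ⟨⁅ν g, f⁆, ⟨.ofAdd (-(abClass f.base.1 ⊗ₜ abClass g), -(abClass g ⊗ₜ abClass f.base.2)),
      ?_⟩, by rw [← (hF.commute _ f _).eq, commutatorElement_def]; group⟩
    refine (hκapply _ _).trans ?_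
    simp only [map_neg, LinearMap.rTensor_tmul, LinearMap.lTensor_tmul, abMap_abClass,
      hA.commutatorValue_neg, hA.commutatorValue_tmul,
      hC.commutatorValue_neg, hC.commutatorValue_tmul]
    refine BiadditiveMap.Extension.ext (Prod.ext ?_ ?_) ?_
    · exact commutatorElement_inv _ _
    · change ⁅j g, f.base.2⁆⁻¹ = ⁅(j g)⁻¹, f.base.2⁆
      rw [eq_comm, eq_inv_iff_mul_eq_one, ← hC.commutatorElement_mul_left, inv_mul_cancel,
        commutatorElement_one_left]
    · rw [BiadditiveMap.Extension.fiber_commutator]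
      simp only [ν, coproductPairing_apply, abClass_inv, TensorProduct.tmul_neg]
      abel
  obtain ⟨N, hN, hmem⟩ := exists_normal_of_mul_mem κ.range hκ ν hmul hcomm
  let l : A →* NilTwoCoproduct A C := BiadditiveMap.Extension.lift (MonoidHom.inl A C)
    fun x y => by simp [coproductPairing_apply]
  let r : C →* NilTwoCoproduct A C := BiadditiveMap.Extension.lift (MonoidHom.inr A C)
    fun x y => by simp [coproductPairing_apply]
  have hrl : ∀ a c, (r c)⁻¹ * l a = ⟨(a, c⁻¹), 0⟩ := fun a c => by
    refine BiadditiveMap.Extension.ext (Prod.ext ?_ ?_) ?_ <;>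
    simp [l, r, coproductPairing_apply]
  refine ⟨NilTwoCoproduct A C ⧸ N, inferInstance, (QuotientGroup.mk' N).comp l,
    (QuotientGroup.mk' N).comp r, hF.of_surjective _ (QuotientGroup.mk'_surjective N), ?_, ?_⟩
  · intro g
    refine (QuotientGroup.eq.2 ?_).symm
    rw [hrl, hmem]
    refine ⟨g, κ (.ofAdd (-(abClass (i g) ⊗ₜ abClass g), 0)), ⟨_, rfl⟩, ?_⟩
    rw [hκapply]
    simp only [map_zero, map_neg, LinearMap.lTensor_tmul, abMap_abClass, hC.commutatorValue_zero,
      hA.commutatorValue_neg, hA.commutatorValue_tmul, commutatorElement_self, inv_one]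
    refine BiadditiveMap.Extension.ext (Prod.ext ?_ ?_) ?_ <;>
    simp [ν, coproductPairing_apply]
  · intro a c h
    have h' := QuotientGroup.eq.1 (Eq.symm h)
    rw [hrl, hmem] at h'
    obtain ⟨g, _, ⟨⟨x, y⟩, rfl⟩, h'⟩ := h'
    have ha : i g * hA.commutatorValue ((abMap i).lTensor _ x) = a :=
      congrArg (fun z => z.base.1) h'
    have hc : (j g)⁻¹ * hC.commutatorValue ((abMap j).rTensor _ y) = c⁻¹ :=
      congrArg (fun z => z.base.2) h'
    have ht : -(abClass (i g) ⊗ₜ abClass (j g)) + (-((abMap j).lTensor _ x) -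
        (abMap i).rTensor _ y) + abClass (i g) ⊗ₜ[ℤ] abClass (hC.commutatorValue _) = 0 :=
      congrArg (fun z => z.fiber) h'
    rw [abClass_eq_zero_iff.2 (hC.commutatorValue_mem _), TensorProduct.tmul_zero, add_zero] at ht
    -- The fibre equation puts both relator components, up to i(g) ⊗ g, into Gᵃᵇ ⊗ Gᵃᵇ. That extra
    -- term is harmless because [i(g), i(g)] = 1.
    obtain ⟨w, hx, rfl⟩ := hi.exists_of_lTensor_add_rTensor_eq_zero hj
      (x + abClass (i g) ⊗ₜ abClass g) y (by
        rw [map_add, LinearMap.lTensor_tmul, abMap_abClass, ← neg_eq_zero, ← ht]; abel)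
    have hx' : hA.commutatorValue ((abMap i).lTensor _ x) = i (hG.commutatorValue w) := by
      rw [← hG.commutatorValue_map hA i, ← LinearMap.lTensor_comp_rTensor, LinearMap.comp_apply,
        ← hx, map_add, LinearMap.lTensor_tmul, abMap_abClass, hA.commutatorValue_add,
        hA.commutatorValue_tmul, commutatorElement_self, mul_one]
    -- The commutators adjusting `g` in `A` and in `C` are both images of the one given by `w`.
    refine ⟨g * hG.commutatorValue w, by rw [map_mul, ← hx', ha], ?_⟩
    rw [map_neg, hC.commutatorValue_neg, ← LinearMap.comp_apply, LinearMap.rTensor_comp_lTensor,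
      hG.commutatorValue_map hC j, ← mul_inv_rev, inv_inj, ← map_mul] at hc
    rw [← hc, (hG.commute_of_mem (hG.commutatorValue_mem w) g).eq]

end Amalgamation

/-! ### The equivalence. -/

theorem Amalgam.StronglyEmbeddable.weaklyEmbeddable {𝒞 : GroupClass.{u}} {G : Type u} [Group G]
    {𝒜 : Amalgam G} (h : 𝒜.StronglyEmbeddable 𝒞) : 𝒜.WeaklyEmbeddable 𝒞 := by
  obtain ⟨M, _, hM, f, _⟩ := h
  exact ⟨M, _, hM, ⟨f⟩⟩

/-- A group of exponent dividing the odd number `m` is a strong amalgamation base for `N₂` if all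
amalgams of groups in `N₂ ∩ B_m` over it embed weakly in an `N₂`-group. -/
theorem isStrongAmalgamationBase_of_weaklyEmbeddable {m : ℕ} (hm : Odd m) {G : Type u} [Group G]
    (hG : NilTwoBurnside m G)
    (H : ∀ 𝒜 : Amalgam G, 𝒜.Of (NilTwoBurnside m) → 𝒜.WeaklyEmbeddable NilTwo) :
    IsStrongAmalgamationBase NilTwo G := by
  refine ⟨hG.1, fun 𝒜 h𝒜 => ?_⟩
  obtain ⟨M, _, l, r, hM, hlr, hstrong⟩ := exists_strong_embedding hG.1 h𝒜.2.1 h𝒜.2.2 𝒜.toLeft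
    𝒜.toRight
    (pureMono_abMap fun q g a s hs h => exists_eq_pow_mul_of_weaklyEmbeddable hm hG H h𝒜.2.1
      𝒜.toLeft 𝒜.toLeft_injective q g a s hs h)
    (pureMono_abMap fun q g a s hs h => exists_eq_pow_mul_of_weaklyEmbeddable hm hG H h𝒜.2.2
      𝒜.toRight 𝒜.toRight_injective q g a s hs h)
  -- A kernel element is identified with `1` in the other factor, so it comes from a core element
  -- that is trivial there.
  have hl : Function.Injective l := by
    rw [injective_iff_map_eq_one]
    intro a ha
    obtain ⟨g, rfl, hg⟩ := hstrong a 1 (by rw [ha, map_one])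
    rw [(map_eq_one_iff _ 𝒜.toRight_injective).1 hg, map_one]
  have hr : Function.Injective r := by
    rw [injective_iff_map_eq_one]
    intro c hc
    obtain ⟨g, hg, rfl⟩ := hstrong 1 c (by rw [hc, map_one])
    rw [(map_eq_one_iff _ 𝒜.toLeft_injective).1 hg, map_one]
  refine ⟨M, _, hM, ⟨l, r, l.comp 𝒜.toLeft, hl, hr, hl.comp 𝒜.toLeft_injective, rfl,
    MonoidHom.ext fun g => (hlr g).symm⟩, fun a ha c _ hac => ?_⟩
  obtain ⟨g, hg, _⟩ := hstrong a c hac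
  exact ha ⟨g, hg⟩

theorem mainTheorem8 (p : ℕ) (hp : p.Prime) (hodd : p ≠ 2) (n : ℕ)
    (G : Type u) [Group G] (hG : NilTwoBurnside (p ^ n) G) :
    (IsStrongAmalgamationBase NilTwo G ↔
      ∀ 𝒜 : Amalgam G, 𝒜.Of (NilTwoBurnside (p ^ n)) → 𝒜.StronglyEmbeddable NilTwo) ∧
    (IsStrongAmalgamationBase NilTwo G ↔
      ∀ 𝒜 : Amalgam G, 𝒜.Of (NilTwoBurnside (p ^ n)) → 𝒜.WeaklyEmbeddable NilTwo) := by
  have h₁ : IsStrongAmalgamationBase NilTwo G →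
      ∀ 𝒜 : Amalgam G, 𝒜.Of (NilTwoBurnside (p ^ n)) → 𝒜.StronglyEmbeddable NilTwo :=
    fun h 𝒜 h𝒜 => h.2 𝒜 ⟨h𝒜.1.1, h𝒜.2.1.1, h𝒜.2.2.1⟩
  have h₂ := isStrongAmalgamationBase_of_weaklyEmbeddable
    ((hp.odd_of_ne_two hodd).pow (n := n)) hG
  exact ⟨⟨h₁, fun h => h₂ fun 𝒜 h𝒜 => (h 𝒜 h𝒜).weaklyEmbeddable⟩,
    ⟨fun h 𝒜 h𝒜 => (h₁ h 𝒜 h𝒜).weaklyEmbeddable, h₂⟩⟩
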